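/- Words are over a finite alphabet; infinite words are indexed by $0,1,2,\dots$. For a rational number $\alpha\ge 1$, an *$\alpha$-power* is a finite word $x^{\lfloor\alpha\rfloor}x'$ of length exactly $\alpha|x|$, where $x$ is a nonempty word and $x'$ is a prefix of $x$. For a real number $\alpha$, an *$\alpha^+$-power* is a $\beta$-power for some rational $\beta>\alpha$. A *circular factor* of an infinite word $w$ is a factor of a conjugate (cyclic shift) of a finite factor of $w$. The word $w$ is *circularly $\alpha^+$-power-free* if no circular factor of $w$ is an $\alpha^+$-power, and *circularly $\alpha$-power-free* if, in addition, no circular factor of $w$ is an $\alpha$-power. Let $\mathrm{RTC}(k)$ denote the smallest real number $r$ for which there is an infinite circularly $r^+$-power-free word over a $k$-letter alphabet. Let $\psi$ be the morphism on $\{0,\dots,5\}^*$ given by $$0\mapsto 0435,\quad 1\mapsto 2341,\quad 2\mapsto 3542,\quad 3\mapsto 3540,\quad 4\mapsto 4134,\quad 5\mapsto 4105,$$ let $\psi^\omega(0)$ be its infinite fixed point starting with $0$, and let $\mu:\{0,\dots,5\}^*\to\{0,1,2\}^*$ be the morphism given by $$0\mapsto 012102120102012,\quad 1\mapsto 201020121012021,\quad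 2\mapsto 012102010212010,$$ $$3\mapsto 201210212021012,\quad 4\mapsto 102120121012021,\quad 5\mapsto 102010212021012.$$ **Theorem.** $\mathrm{RTC}(3)=\frac{13}{4}$ (in particular, the smallest such $r$ exists). Moreover, no infinite word over a $3$-letter alphabet is circularly $\frac{13}{4}$-power-free, that is, every infinite ternary word has a circular factor which is a $\beta$-power for some rational $\beta\ge\frac{13}{4}$; and the infinite word $\mu(\psi^\omega(0))$ is circularly $\left(\frac{13}{4}\right)^+$-power-free. -/

import Mathlib

namespace CircularWords

/-! Finite words are lists, and (right) infinite words over `A` are functions `ℕ → A`. -/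

/-- `w` is an `α`-power, for a rational number `α ≥ 1`: it has the form `x^⌊α⌋ x'` where `x` is a
nonempty word, `x'` is a prefix of `x`, and `|w| = α |x|`. -/
def IsPower {A : Type*} (α : ℚ) (w : List A) : Prop :=
  1 ≤ α ∧ ∃ x x' : List A, x ≠ [] ∧ x' <+: x ∧
    w = (List.replicate ⌊α⌋₊ x).flatten ++ x' ∧ (w.length : ℚ) = α * (x.length : ℚ)

/-- `w` is an `α⁺`-power, for a real number `α`: it is a `β`-power for some `β > α`. -/
def IsPlusPower {A : Type*} (α : ℝ) (w : List A) : Prop :=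
  ∃ β : ℚ, α < (β : ℝ) ∧ IsPower β w

/-- The factor of length `n` of the infinite word `w` that starts at position `i`. -/
def factorAt {A : Type*} (w : ℕ → A) (i n : ℕ) : List A :=
  (List.range n).map (fun j => w (i + j))

/-- The finite word `f` is a factor of the infinite word `w`. -/
def IsFactor {A : Type*} (f : List A) (w : ℕ → A) : Prop :=
  ∃ i n : ℕ, f = factorAt w i n

/-- `x` and `y` are conjugate: there are words `u`, `v` with `x = uv` and `y = vu`. -/
def IsConjugate {A : Type*} (x y : List A) : Prop :=
  ∃ u v : List A, x = u ++ v ∧ y = v ++ u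

/-- `s` is a circular factor of `w`: a factor of a conjugate of a factor of `w`. -/
def IsCircularFactor {A : Type*} (s : List A) (w : ℕ → A) : Prop :=
  ∃ f c : List A, IsFactor f w ∧ IsConjugate f c ∧ s <:+: c

/-- `w` is circularly `α⁺`-power-free (avoids circular `α⁺`-powers). -/
def CircularlyPlusPowerFree {A : Type*} (α : ℝ) (w : ℕ → A) : Prop :=
  ∀ s : List A, IsCircularFactor s w → ¬ IsPlusPower α s

/-- `w` is circularly `α`-power-free (avoids circular `α`-powers): it is circularly
`α⁺`-power-free and, in addition, no circular factor of `w` is an `α`-power. -/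
def CircularlyPowerFree {A : Type*} (α : ℚ) (w : ℕ → A) : Prop :=
  CircularlyPlusPowerFree (α : ℝ) w ∧ ∀ s : List A, IsCircularFactor s w → ¬ IsPower α s

/-- `r` is the repetition threshold for circular factors over a `k`-letter alphabet: the smallest
real number `r` for which there is an infinite circularly `r⁺`-power-free word over `k` letters. -/
def IsCircularRepetitionThreshold (k : ℕ) (r : ℝ) : Prop :=
  IsLeast {r : ℝ | ∃ w : ℕ → Fin k, CircularlyPlusPowerFree r w} r

/-! A `q`-uniform morphism is given by the images of the letters, as functions on `Fin q`. -/

/-- The image of a finite word under the `q`-uniform morphism `h`. -/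
def applyMorphism {A B : Type*} {q : ℕ} (h : A → Fin q → B) (w : List A) : List B :=
  w.flatMap (fun a => List.ofFn (h a))

/-- The image of an infinite word under the `q`-uniform morphism `h`. -/
def applyMorphismInf {A B : Type*} {q : ℕ} [NeZero q] (h : A → Fin q → B) (w : ℕ → A) : ℕ → B :=
  fun n => h (w (n / q)) (Fin.ofNat q n)

/-- The infinite word `h^ω(a)`, for a `q`-uniform morphism `h` with `q ≥ 2` such that `h(a)` starts
with `a`: its letter at position `n` is the one of the finite word `h^(n+1)(a)`, which has length
`q^(n+1) > n`. -/
def omegaPower {A : Type*} {q : ℕ} (h : A → Fin q → A) (a : A) : ℕ → A :=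
  fun n => ((applyMorphism h)^[n + 1] [a]).getD n a

/-- The `4`-uniform morphism `ψ` on six letters. -/
def psi : Fin 6 → Fin 4 → Fin 6 :=
  ![![0, 4, 3, 5],
    ![2, 3, 4, 1],
    ![3, 5, 4, 2],
    ![3, 5, 4, 0],
    ![4, 1, 3, 4],
    ![4, 1, 0, 5]]

/-- The `15`-uniform morphism `μ` from six letters to three letters. -/
def mu : Fin 6 → Fin 15 → Fin 3 :=
  ![![0, 1, 2, 1, 0, 2, 1, 2, 0, 1, 0, 2, 0, 1, 2],
    ![2, 0, 1, 0, 2, 0, 1, 2, 1, 0, 1, 2, 0, 2, 1],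
    ![0, 1, 2, 1, 0, 2, 0, 1, 0, 2, 1, 2, 0, 1, 0],
    ![2, 0, 1, 2, 1, 0, 2, 1, 2, 0, 2, 1, 0, 1, 2],
    ![1, 0, 2, 1, 2, 0, 1, 2, 1, 0, 1, 2, 0, 2, 1],
    ![1, 0, 2, 0, 1, 0, 2, 1, 2, 0, 2, 1, 0, 1, 2]]

end CircularWords

namespace CircularWords

/-! ### Coding of factors by natural numbers -/

/-! A repetition of period `p` in a conjugate is, apart from degenerate cuts, a product `vu` of
factors in which the last `p` letters of `v` are the first `p` letters of `u`, with runs of lengths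
`l` and `r` on the two sides. Its length is `l + r + 2p`, so exponent at least 13/4 means `5p ≤ 4(l
+ r)`. This is the `Clash` data.

Lower bound: a word avoiding such products only has to avoid them with `u` before `v`, but between
factors that occur infinitely often the order is free. Every such recurrent word has a recurrent
one-letter extension, so a backtracking search on recurrent words is sound. `searchAll_eq_true`
evaluates a finite search that even the empty word does not survive, hence `not_good`.

Upper bound: the order of `u` and `v` is ignored and all long clashes in the image word are
excluded. Both ψ and μ are synchronizing codes, so `Clash.desubstitute` turns a clash of large
period in an image into one of period `p / q` in the preimage, losing at most `c₁ + c₂` letters of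
run. One step of μ leads to the fixed point of ψ; strong induction there divides the period by 4
while keeping a bounded slack. The small periods are checked on finite lists of factors. -/

/-- The factor of length `n` at position `i`, read as a number in base `8`, lowest digit first. -/
def enc (s : ℕ → ℕ) : ℕ → ℕ → ℕ
  | _, 0 => 0
  | i, n + 1 => s i + 8 * enc s (i + 1) n

lemma enc_lt {s : ℕ → ℕ} (hs : ∀ n, s n < 8) (i n : ℕ) : enc s i n < 8 ^ n := by
  induction n generalizing i with
  | zero => simp [enc]
  | succ n ih =>
    have h₁ := ih (i + 1)
    have h₂ := hs i
    rw [enc, pow_succ]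
    omega

lemma enc_add (s : ℕ → ℕ) (i a b : ℕ) : enc s i (a + b) = enc s i a + 8 ^ a * enc s (i + a) b := by
  induction a generalizing i with
  | zero => simp [enc]
  | succ a ih =>
    rw [show a + 1 + b = (a + b) + 1 by ring, enc, enc, ih, pow_succ,
      show i + (a + 1) = i + 1 + a by ring]
    ring

lemma enc_sub {s : ℕ → ℕ} (hs : ∀ n, s n < 8) (i : ℕ) {a b n : ℕ} (h : a + b ≤ n) :
    enc s i n / 8 ^ a % 8 ^ b = enc s (i + a) b := by
  obtain ⟨c, rfl⟩ := Nat.exists_eq_add_of_le h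
  rw [add_assoc, enc_add, Nat.add_mul_div_left _ _ (by positivity),
    Nat.div_eq_of_lt (enc_lt hs _ _), zero_add, enc_add, Nat.add_mul_mod_self_left,
    Nat.mod_eq_of_lt (enc_lt hs _ _)]

lemma enc_eq_iff {s s' : ℕ → ℕ} (hs : ∀ n, s n < 8) (hs' : ∀ n, s' n < 8) (i j n : ℕ) :
    enc s i n = enc s' j n ↔ ∀ k < n, s (i + k) = s' (j + k) := by
  induction n generalizing i j with
  | zero => simp [enc]
  | succ n ih =>
    have h₁ := hs i
    have h₂ := hs' j
    rw [enc, enc, Nat.forall_lt_succ_left]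
    have := ih (i + 1) (j + 1)
    constructor
    · intro h
      have h₃ : enc s (i + 1) n = enc s' (j + 1) n := by omega
      refine ⟨by simpa using (by omega : s i = s' j), fun k hk => ?_⟩
      simpa [add_assoc, add_comm, add_left_comm] using this.1 h₃ k hk
    · rintro ⟨h₃, h₄⟩
      have h₅ := this.2 fun k hk => by
        simpa [add_assoc, add_comm, add_left_comm] using h₄ k hk
      simp only [add_zero] at h₃
      omega

/-- The code of a finite word. -/
def code (L : List ℕ) : ℕ := L.foldr (fun c x => c + 8 * x) 0

lemma enc_eq_code_iff {s : ℕ → ℕ} (hs : ∀ n, s n < 8) {L : List ℕ} (hL : ∀ c ∈ L, c < 8) (i : ℕ) :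
    enc s i L.length = code L ↔ ∀ k (h : k < L.length), s (i + k) = L[k] := by
  induction L generalizing i with
  | nil => simp [enc, code]
  | cons c L ih =>
    have h₁ := hs i
    have h₂ := hL c (by simp)
    have := ih (fun d hd => hL d (by simp [hd])) (i + 1)
    have hc : code (c :: L) = c + 8 * code L := rfl
    change s i + 8 * enc s (i + 1) L.length = code (c :: L) ↔ _
    rw [hc]
    constructor
    · intro h k hk
      cases k with
      | zero => simp; omega
      | succ k =>
        have := this.1 (by omega) k (by simpa using hk)
        simpa [add_assoc, add_comm, add_left_comm] using this
    · intro h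
      have h₃ := h 0 (by simp)
      have h₄ := this.2 fun k hk => by
        have h₅ : s (i + (k + 1)) = L[k] := h (k + 1) (Nat.succ_lt_succ hk)
        rw [← h₅, add_assoc, add_comm 1 k]
      simp only [add_zero, List.getElem_cons_zero] at h₃
      omega

/-! ### Circular repetitions in terms of positions -/

/-- The factor of length `l + p` at position `i` has period `p`. -/
def Run {A : Type*} (s : ℕ → A) (p i l : ℕ) : Prop := ∀ k < l, s (i + k) = s (i + k + p)

/-- The factors `v` of length `l + p` at `i` and `u` of length `p + r` at `j` have period `p`, and
the last `p` letters of `v` are the first `p` letters of `u`; so `vu` has period `p`. -/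
structure Clash {A : Type*} (s : ℕ → A) (p i l j r : ℕ) : Prop where
  left : Run s p i l
  right : Run s p j r
  mid : ∀ k < p, s (i + l + k) = s (j + k)

/-- A word over `{0, 1, 2}` in which no factor `v` occurring after a factor `u` gives a word `vu` of
exponent at least `13 / 4`. -/
structure Good (s : ℕ → ℕ) : Prop where
  lt_three : ∀ n, s n < 3
  not_clash : ∀ p i l j r, 0 < p → 5 * p ≤ 4 * (l + r) → j + p + r ≤ i → ¬ Clash s p i l j r

lemma Good.lt_eight {s : ℕ → ℕ} (hs : Good s) (n : ℕ) : s n < 8 := by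
  have := hs.lt_three n
  omega

/-- The word of length `n` with code `X` occurs infinitely often. -/
def Recurs (s : ℕ → ℕ) (n X : ℕ) : Prop := ∀ N, ∃ i ≥ N, enc s i n = X

lemma Recurs.sub {s : ℕ → ℕ} (hs : ∀ n, s n < 8) {n X a b : ℕ} (h : Recurs s n X)
    (hab : a + b ≤ n) : Recurs s b (X / 8 ^ a % 8 ^ b) := by
  intro N
  obtain ⟨i, hi, rfl⟩ := h N
  exact ⟨i + a, by omega, (enc_sub hs i hab).symm⟩

/-- Pigeonhole on the letter after infinitely many occurrences. Appending 0 leaves the code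
unchanged, which is why the length is carried along with it. -/
lemma Recurs.extend {s : ℕ → ℕ} (hs : ∀ n, s n < 3) {n X : ℕ} (h : Recurs s n X) :
    Recurs s (n + 1) X ∨ Recurs s (n + 1) (X + 8 ^ n) ∨ Recurs s (n + 1) (X + 2 * 8 ^ n) := by
  by_contra! hcon
  simp only [Recurs, not_forall] at hcon
  push Not at hcon
  obtain ⟨⟨N₀, h₀⟩, ⟨N₁, h₁⟩, ⟨N₂, h₂⟩⟩ := hcon
  obtain ⟨i, hi, hX⟩ := h (N₀ + N₁ + N₂)
  have key : enc s i (n + 1) = X + s (i + n) * 8 ^ n := by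
    rw [enc_add, hX]
    simp only [enc]
    ring
  have hlt := hs (i + n)
  have h₀ := h₀ i (by omega)
  have h₁ := h₁ i (by omega)
  have h₂ := h₂ i (by omega)
  rw [key] at h₀ h₁ h₂
  interval_cases s (i + n) <;> simp_all

/-- Both parts of the clash may lie anywhere in one recurrent word, even overlapping: `u` is taken
in one occurrence and `v` in a later, disjoint one. -/
lemma Good.not_recurs {s : ℕ → ℕ} (hs : Good s) {n X p a l b r : ℕ} (hp : 0 < p)
    (hlr : 5 * p ≤ 4 * (l + r)) (ha : a + l + p ≤ n) (hb : b + p + r ≤ n)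
    (hl : X / 8 ^ a % 8 ^ l = X / 8 ^ (a + p) % 8 ^ l)
    (hr : X / 8 ^ b % 8 ^ r = X / 8 ^ (b + p) % 8 ^ r)
    (hm : X / 8 ^ (a + l) % 8 ^ p = X / 8 ^ b % 8 ^ p) : ¬ Recurs s n X := by
  intro h
  have h8 := hs.lt_eight
  obtain ⟨j, -, hj⟩ := h 0
  obtain ⟨i, hi, hX⟩ := h (j + n)
  refine hs.not_clash p (i + a) l (j + b) r hp hlr (by omega) ⟨?_, ?_, ?_⟩
  · rw [← hX, enc_sub h8 _ (by omega), enc_sub h8 _ (by omega), enc_eq_iff h8 h8] at hl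
    intro k hk
    rw [hl k hk]
    congr 1
    ring
  · rw [← hj, enc_sub h8 _ (by omega), enc_sub h8 _ (by omega), enc_eq_iff h8 h8] at hr
    intro k hk
    rw [hr k hk]
    congr 1
    ring
  · nth_rw 1 [← hX] at hm
    rw [← hj, enc_sub h8 _ (by omega), enc_sub h8 _ (by omega), enc_eq_iff h8 h8] at hm
    intro k hk
    rw [← hm k hk]
    congr 1
    ring

/-! ### The search for good words

The functions below take words as a length and a code. They are defined by plain recursors, with
Boolean operations on numerals, so that the kernel evaluates them quickly. -/

/-- The word has a square of period at most `p` as a suffix. -/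
def sqEnd (X n p : ℕ) : Bool :=
  Nat.rec false (fun p ih => Bool.or
    (Nat.beq (X / 8 ^ (n - 2 * (p + 1)) % 8 ^ (p + 1)) (X / 8 ^ (n - (p + 1)) % 8 ^ (p + 1))) ih) p

/-- One of the first `m` suffixes of `Y` starts with a word with code `z` and length `p`, and with a
word of length `p + r` and period `p`. -/
def findU (p r z m : ℕ) : ℕ → Bool :=
  Nat.rec (fun _ => false) (fun _ ih Y => Bool.or
    (Bool.and (Nat.beq (Y % 8 ^ p) z) (Nat.beq (Y % 8 ^ r) (Y / 8 ^ p % 8 ^ r))) (ih (Y / 8))) m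

/-- One of the first `m` suffixes of `Y` starts with a word of length `l + p` and period `p`, whose
last `p` letters have code `z`. -/
def findV (p l z m : ℕ) : ℕ → Bool :=
  Nat.rec (fun _ => false) (fun _ ih Y => Bool.or
    (Bool.and (Nat.beq (Y / 8 ^ l % 8 ^ p) z) (Nat.beq (Y % 8 ^ l) (Y / 8 ^ p % 8 ^ l)))
    (ih (Y / 8))) m

/-- The word has factors as in `Clash`, one of which is a suffix. -/
def clashEnd (X n p l r : ℕ) : Bool :=
  (Nat.ble (l + p) n && Nat.beq (X / 8 ^ (n - l - p) % 8 ^ l) (X / 8 ^ (n - l) % 8 ^ l) &&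
    findU p r (X / 8 ^ (n - p) % 8 ^ p) (n + 1 - p - r) X) ||
  (Nat.ble (p + r) n && Nat.beq (X / 8 ^ (n - r - p) % 8 ^ r) (X / 8 ^ (n - r) % 8 ^ r) &&
    findV p l (X / 8 ^ (n - p - r) % 8 ^ p) (n + 1 - p - l) X)

/-- The word has one of the forbidden words as a suffix. -/
def forbEnd (forb : List (ℕ × ℕ)) (X n : ℕ) : Bool :=
  forb.any fun f => Nat.ble f.1 n && Nat.beq (X / 8 ^ (n - f.1) % 8 ^ f.1) f.2

/-- A sufficient condition for a word not to occur infinitely often in a good word. -/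
def badEnd (forb : List (ℕ × ℕ)) (X n : ℕ) : Bool :=
  sqEnd X n (n / 2) || forbEnd forb X n ||
  clashEnd X n 3 2 2 || clashEnd X n 4 2 3 || clashEnd X n 4 3 2 || clashEnd X n 8 7 3 ||
  clashEnd X n 8 6 4 || clashEnd X n 8 5 5 || clashEnd X n 8 4 6 || clashEnd X n 8 3 7

/-- All extensions of the word to the right are eventually bad. -/
def search (forb : List (ℕ × ℕ)) (fuel : ℕ) : ℕ → ℕ → Bool :=
  Nat.rec (fun _ _ => false) (fun _ ih X n => badEnd forb X n ||
    (ih X (n + 1) && ih (X + 8 ^ n) (n + 1) && ih (X + 2 * 8 ^ n) (n + 1))) fuel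

/-! ### Soundness of the search -/

lemma sqEnd_sound {s : ℕ → ℕ} (hs : Good s) {X n p : ℕ} (hp : 2 * p ≤ n) (h : sqEnd X n p = true) :
    ¬ Recurs s n X := by
  induction p with
  | zero => simp [sqEnd] at h
  | succ p ih =>
    change Bool.or _ (sqEnd X n p) = true at h
    rw [Bool.or_eq_true, Nat.beq_eq] at h
    rcases h with h | h
    · have e : n - 2 * (p + 1) + (p + 1) = n - (p + 1) := by omega
      exact hs.not_recurs (p := p + 1) (a := n - 2 * (p + 1)) (b := n - 2 * (p + 1)) (l := p + 1)
        (r := p + 1) (by omega) (by omega) (by omega) (by omega) (by rw [e, h]) (by rw [e, h])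
        (by rw [e, h])
    · exact ih (by omega) h

lemma findU_spec {p r z m Y : ℕ} (h : findU p r z m Y = true) :
    ∃ b < m, Y / 8 ^ b % 8 ^ p = z ∧ Y / 8 ^ b % 8 ^ r = Y / 8 ^ (b + p) % 8 ^ r := by
  induction m generalizing Y with
  | zero => simp [findU] at h
  | succ m ih =>
    change Bool.or _ (findU p r z m (Y / 8)) = true at h
    rw [Bool.or_eq_true, Bool.and_eq_true, Nat.beq_eq, Nat.beq_eq] at h
    rcases h with h | h
    · exact ⟨0, by omega, by simpa using h⟩
    · obtain ⟨b, hb, h₁, h₂⟩ := ih h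
      rw [Nat.div_div_eq_div_mul, ← pow_succ'] at h₁ h₂
      rw [Nat.div_div_eq_div_mul, ← pow_succ'] at h₂
      exact ⟨b + 1, by omega, h₁, by rw [h₂, show b + 1 + p = b + p + 1 by ring]⟩

lemma findV_spec {p l z m Y : ℕ} (h : findV p l z m Y = true) :
    ∃ a < m, Y / 8 ^ (a + l) % 8 ^ p = z ∧ Y / 8 ^ a % 8 ^ l = Y / 8 ^ (a + p) % 8 ^ l := by
  induction m generalizing Y with
  | zero => simp [findV] at h
  | succ m ih =>
    change Bool.or _ (findV p l z m (Y / 8)) = true at h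
    rw [Bool.or_eq_true, Bool.and_eq_true, Nat.beq_eq, Nat.beq_eq] at h
    rcases h with h | h
    · exact ⟨0, by omega, by simpa using h⟩
    · obtain ⟨b, hb, h₁, h₂⟩ := ih h
      rw [Nat.div_div_eq_div_mul, ← pow_succ'] at h₁ h₂
      rw [Nat.div_div_eq_div_mul, ← pow_succ'] at h₂
      exact ⟨b + 1, by omega, by rw [← h₁, show b + 1 + l = b + l + 1 by ring],
        by rw [h₂, show b + 1 + p = b + p + 1 by ring]⟩

lemma clashEnd_sound {s : ℕ → ℕ} (hs : Good s) {X n p l r : ℕ} (hp : 0 < p)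
    (hlr : 5 * p ≤ 4 * (l + r)) (h : clashEnd X n p l r = true) : ¬ Recurs s n X := by
  simp only [clashEnd, Bool.or_eq_true, Bool.and_eq_true, Nat.beq_eq, Nat.ble_eq] at h
  rcases h with ⟨⟨h₀, h₁⟩, h₂⟩ | ⟨⟨h₀, h₁⟩, h₂⟩
  · obtain ⟨b, hb, h₃, h₄⟩ := findU_spec h₂
    refine hs.not_recurs (a := n - l - p) hp hlr (by omega) (by omega) ?_ h₄ ?_
    · rw [h₁, show n - l - p + p = n - l by omega]
    · rw [h₃, show n - l - p + l = n - p by omega]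
  · obtain ⟨a, ha, h₃, h₄⟩ := findV_spec h₂
    refine hs.not_recurs (b := n - r - p) hp hlr (by omega) (by omega) h₄ ?_ ?_
    · rw [h₁, show n - r - p + p = n - r by omega]
    · rw [h₃, show n - p - r = n - r - p by omega]

lemma badEnd_sound {s : ℕ → ℕ} (hs : Good s) {forb : List (ℕ × ℕ)}
    (hf : ∀ f ∈ forb, ¬ Recurs s f.1 f.2) {X n : ℕ} (h : badEnd forb X n = true) :
    ¬ Recurs s n X := by
  simp only [badEnd, Bool.or_eq_true] at h
  rcases h with ((((((((h | h) | h) | h) | h) | h) | h) | h) | h) | h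
  · exact sqEnd_sound hs (by omega) h
  · simp only [forbEnd, List.any_eq_true, Bool.and_eq_true, Nat.beq_eq, Nat.ble_eq] at h
    obtain ⟨f, hfm, hn, hX⟩ := h
    intro hr
    have := hr.sub hs.lt_eight (a := n - f.1) (b := f.1) (by omega)
    rw [hX] at this
    exact hf f hfm this
  -- In each case `l + r` is the least integer that is at least `5p/4`: 4, 5 and 10 for `p` = 3, 4
  -- and 8, with equality in the last two.
  all_goals exact clashEnd_sound hs (by norm_num) (by norm_num) h

lemma search_sound {s : ℕ → ℕ} (hs : Good s) {forb : List (ℕ × ℕ)}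
    (hf : ∀ f ∈ forb, ¬ Recurs s f.1 f.2) {fuel X n : ℕ} (h : search forb fuel X n = true) :
    ¬ Recurs s n X := by
  induction fuel generalizing X n with
  | zero => simp [search] at h
  | succ fuel ih =>
    change (badEnd forb X n || (search forb fuel X (n + 1) && search forb fuel (X + 8 ^ n) (n + 1) &&
      search forb fuel (X + 2 * 8 ^ n) (n + 1))) = true at h
    simp only [Bool.or_eq_true, Bool.and_eq_true] at h
    rcases h with h | ⟨⟨h₀, h₁⟩, h₂⟩
    · exact badEnd_sound hs hf h
    · intro hr
      rcases hr.extend hs.lt_three with hr | hr | hr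
      exacts [ih h₀ hr, ih h₁ hr, ih h₂ hr]

/-- The permutations of `{0, 1, 2}`. -/
def perms : List (List ℕ) := [[0, 1, 2], [0, 2, 1], [1, 0, 2], [1, 2, 0], [2, 0, 1], [2, 1, 0]]

/-- Search for right extensions of each seed in turn, forbidding the earlier seeds, up to
permutations of the letters; then search for any word. -/
def searchAll : List (List ℕ) → List (ℕ × ℕ) → Bool
  | [], forb => search forb 120 0 0
  | L :: rest, forb => L.all (fun c => decide (c < 3)) && search forb 120 (code L) L.length &&
      searchAll rest (perms.map (fun π => (L.length, code (L.map fun c => π.getD c 0))) ++ forb)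

lemma perms_inverse : ∀ π ∈ perms, ∃ τ ∈ perms, ∀ x < 3, τ.getD (π.getD x 0) 0 = x ∧
    π.getD (τ.getD x 0) 0 = x ∧ τ.getD x 0 < 3 ∧ π.getD x 0 < 3 := by
  decide

/-- Clashes only compare letters, so an injective renaming preserves goodness. Excluding one seed
from all good words thus excludes its images under the permutations. -/
lemma Good.relabel {s : ℕ → ℕ} (hs : Good s) {τ σ : ℕ → ℕ} (hτ : ∀ x < 3, τ x < 3)
    (hσ : ∀ x < 3, σ (τ x) = x) : Good (τ ∘ s) := by
  have inj : ∀ a b, (τ ∘ s) a = (τ ∘ s) b → s a = s b := fun a b h => by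
    rw [← hσ _ (hs.lt_three a), ← hσ _ (hs.lt_three b)]
    exact congrArg σ h
  refine ⟨fun n => hτ _ (hs.lt_three n), fun p i l j r hp hlr hij h => ?_⟩
  exact hs.not_clash p i l j r hp hlr hij ⟨fun k hk => inj _ _ (h.left k hk),
    fun k hk => inj _ _ (h.right k hk), fun k hk => inj _ _ (h.mid k hk)⟩

lemma searchAll_sound {seeds : List (List ℕ)} {forb : List (ℕ × ℕ)}
    (hf : ∀ s, Good s → ∀ f ∈ forb, ¬ Recurs s f.1 f.2) (h : searchAll seeds forb = true)
    (s : ℕ → ℕ) : ¬ Good s := by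
  induction seeds generalizing forb with
  -- The empty word occurs everywhere, so it is recurrent.
  | nil => exact fun hs => search_sound hs (hf s hs) h fun N => ⟨N, le_rfl, rfl⟩
  | cons L rest ih =>
    simp only [searchAll, Bool.and_eq_true, List.all_eq_true, decide_eq_true_eq] at h
    obtain ⟨⟨hL, h₁⟩, h₂⟩ := h
    refine ih (fun s hs f hfm => ?_) h₂
    rw [List.mem_append, List.mem_map] at hfm
    rcases hfm with ⟨π, hπ, rfl⟩ | hfm
    · obtain ⟨τ, -, hτ⟩ := perms_inverse π hπ
      intro hr
      have hg : Good ((fun x => τ.getD x 0) ∘ s) :=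
        hs.relabel (σ := fun x => π.getD x 0) (fun x hx => (hτ x hx).2.2.1)
          (fun x hx => (hτ x hx).2.1)
      refine search_sound hg (hf _ hg) h₁ fun N => ?_
      obtain ⟨i, hi, he⟩ := hr N
      refine ⟨i, hi, (enc_eq_code_iff hg.lt_eight (fun c hc => by have := hL c hc; omega) i).2 ?_⟩
      have he' : enc s i (L.map fun c => π.getD c 0).length = code (L.map fun c => π.getD c 0) := by
        simpa using he
      rw [enc_eq_code_iff hs.lt_eight] at he'
      · intro k hk
        have := he' k (by simpa using hk)
        simp only [Function.comp_apply, this, List.getElem_map]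
        exact (hτ _ (hL _ (List.getElem_mem hk))).1
      · intro c hc
        obtain ⟨d, hd, rfl⟩ := List.mem_map.1 hc
        have := (hτ d (hL d hd)).2.2.2
        omega
    · exact hf s hs f hfm

set_option maxRecDepth 100000 in
lemma searchAll_eq_true : searchAll [[0, 1, 0, 2, 0, 1, 2, 0, 2, 1, 0, 2],
    [0, 1, 2, 0, 2, 1, 0, 2, 0, 1, 2, 0], [0, 1, 2, 1, 0, 1, 2, 0, 1, 0, 2, 0],
    [0, 1, 2, 1, 0, 2, 0, 1, 0, 2, 1, 0], [0, 1, 0, 2, 1, 2, 0, 1, 2, 1, 0, 1],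
    [0, 1, 2, 0, 1], [0, 1, 0, 2, 0]] [] = true := by
  decide +kernel

theorem not_good (s : ℕ → ℕ) : ¬ Good s :=
  searchAll_sound (forb := []) (by simp) searchAll_eq_true s

/-! ### Powers and periods of finite words -/

/-- The finite word `s` has period `p`. -/
def HasPeriod {A : Type*} (p : ℕ) (s : List A) : Prop :=
  ∀ k, k + p < s.length → s[k]? = s[k + p]?

lemma isPower_of_hasPeriod {A : Type*} {p : ℕ} {s : List A} (hp : 0 < p) (hs : HasPeriod p s)
    (hl : p ≤ s.length) : IsPower ((s.length : ℚ) / p) s := by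
  have hp' : (0 : ℚ) < p := by exact_mod_cast hp
  have hx : (s.take p).length = p := by simp [hl]
  -- A word `t` that is a prefix of `xt` is a power of `x` followed by a prefix of `x`: strip copies
  -- of `x` while `t` is at least as long as `x`.
  have main : ∀ n (t : List A), t.length = n → t <+: s.take p ++ t →
      ∃ x', x' <+: s.take p ∧ t = (List.replicate (n / p) (s.take p)).flatten ++ x' := by
    intro n
    induction n using Nat.strong_induction_on with
    | _ n ih =>
      intro t ht hpre
      rcases lt_or_ge n p with h | h
      · refine ⟨t, List.prefix_of_prefix_length_le hpre (List.prefix_append _ _) (by omega), ?_⟩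
        simp [Nat.div_eq_of_lt h]
      · obtain ⟨t', rfl⟩ : s.take p <+: t :=
          List.prefix_of_prefix_length_le (List.prefix_append _ _) hpre (by omega)
        rw [List.prefix_append_right_inj] at hpre
        rw [List.length_append, hx] at ht
        obtain ⟨x', hx', ht'⟩ := ih (n - p) (by omega) t' (by omega) hpre
        refine ⟨x', hx', ?_⟩
        conv_lhs => rw [ht']
        rw [Nat.div_eq_sub_div hp h, List.replicate_succ, List.flatten_cons, List.append_assoc]
  have hpre : s <+: s.take p ++ s := by
    rw [List.prefix_iff_getElem?]
    intro k hk
    rw [← List.getElem?_eq_getElem hk]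
    rcases lt_or_ge k p with h | h
    · rw [List.getElem?_append_left (by omega), List.getElem?_take_of_lt h]
    · rw [List.getElem?_append_right (by omega), hx, hs (k - p) (by omega), Nat.sub_add_cancel h]
  obtain ⟨x', hx', h⟩ := main s.length s rfl hpre
  refine ⟨?_, s.take p, x', ?_, hx', ?_, ?_⟩
  · rw [le_div_iff₀ hp']
    exact_mod_cast (by omega : 1 * p ≤ s.length)
  · intro h0
    rw [h0] at hx
    simp at hx
    omega
  · rw [Nat.floor_div_eq_div]
    exact h
  · rw [hx]
    field_simp

lemma IsPower.hasPeriod {A : Type*} {β : ℚ} {s : List A} (h : IsPower β s) :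
    ∃ p, 0 < p ∧ HasPeriod p s ∧ (s.length : ℚ) = β * p := by
  obtain ⟨-, x, x', hx, hx', hs, hl⟩ := h
  refine ⟨x.length, List.length_pos_iff.2 hx, ?_, hl⟩
  have hpre : s <+: x ++ s := by
    have e : ∀ n, x ++ (List.replicate n x).flatten = (List.replicate n x).flatten ++ x := by
      intro n
      induction n with
      | zero => simp
      | succ n ih => rw [List.replicate_succ, List.flatten_cons, List.append_assoc, ← ih]
    rw [hs, ← List.append_assoc, e, List.append_assoc, List.prefix_append_right_inj]
    exact hx'.trans (List.prefix_append _ _)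
  intro k hk
  rw [List.prefix_iff_getElem?] at hpre
  have := hpre (k + x.length) hk
  rw [List.getElem?_append_right (by omega), Nat.add_sub_cancel] at this
  rw [this, List.getElem?_eq_getElem hk]

/-! ### Circular factors -/

@[simp] lemma length_factorAt {A : Type*} (w : ℕ → A) (i n : ℕ) : (factorAt w i n).length = n := by
  simp [factorAt]

lemma getElem?_factorAt {A : Type*} (w : ℕ → A) {i n k : ℕ} (h : k < n) :
    (factorAt w i n)[k]? = some (w (i + k)) := by
  simp [factorAt, h]

lemma factorAt_add {A : Type*} (w : ℕ → A) (i m n : ℕ) :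
    factorAt w i (m + n) = factorAt w i m ++ factorAt w (i + m) n := by
  simp [factorAt, List.range_add, Function.comp_def, add_assoc]

lemma getElem?_append_factorAt {A : Type*} (w : ℕ → A) {i j m n k : ℕ} (h : k < m + n) :
    (factorAt w i m ++ factorAt w j n)[k]? =
      some (if k < m then w (i + k) else w (j + (k - m))) := by
  split_ifs with hk
  · rw [List.getElem?_append_left (by simpa using hk), getElem?_factorAt w hk]
  · rw [List.getElem?_append_right (by simpa using hk), length_factorAt,
      getElem?_factorAt w (by omega)]

lemma Clash.hasPeriod {A : Type*} {w : ℕ → A} {p i l j r : ℕ} (h : Clash w p i l j r) :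
    HasPeriod p (factorAt w i (l + p) ++ factorAt w j (p + r)) := by
  intro k hk
  simp only [List.length_append, length_factorAt] at hk
  rw [getElem?_append_factorAt w (by omega), getElem?_append_factorAt w (by omega)]
  congr 1
  rcases lt_or_ge k l with h₁ | h₁
  · rw [if_pos (by omega), if_pos (by omega), h.left k h₁, add_assoc]
  rcases lt_or_ge k (l + p) with h₂ | h₂
  · have := h.mid (k - l) (by omega)
    rw [if_pos h₂, if_neg (by omega), show k + p - (l + p) = k - l by omega, ← this]
    congr 1
    omega
  · have := h.right (k - (l + p)) (by omega)
    rw [if_neg (by omega), if_neg (by omega), this]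
    congr 1
    omega

lemma exists_clash {A : Type*} {w : ℕ → A} {p i m j n : ℕ} (h : 13 * p < 4 * (m + n))
    (hper : HasPeriod p (factorAt w i m ++ factorAt w j n)) :
    ∃ i l j r, 5 * p < 4 * (l + r) ∧ Clash w p i l j r := by
  have key : ∀ k, k + p < m + n → (if k < m then w (i + k) else w (j + (k - m))) =
      if k + p < m then w (i + (k + p)) else w (j + (k + p - m)) := by
    intro k hk
    have := hper k (by simpa using hk)
    rwa [getElem?_append_factorAt w (by omega), getElem?_append_factorAt w (by omega),
      Option.some_inj] at this
  have runL : Run w p i (m - p) := fun k hk => by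
    have := key k (by omega)
    rwa [if_pos (by omega), if_pos (by omega), ← add_assoc] at this
  have runR : Run w p j (n - p) := fun k hk => by
    have := key (m + k) (by omega)
    rw [if_neg (by omega), if_neg (by omega)] at this
    convert this using 2 <;> omega
  rcases lt_or_ge m p with hm | hm
  -- The part `v` is shorter than the period, so `u` alone has a run longer than `5p/4`; its first
  -- `p` letters play the role of `v`. The next case is symmetric.
  · exact ⟨j, 0, j, n - p, by omega, fun k hk => by omega, runR, fun k _ => rfl⟩
  rcases lt_or_ge n p with hn | hn
  · exact ⟨i, m - p, i + (m - p), 0, by omega, runL, fun k hk => by omega, fun k _ => rfl⟩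
  · refine ⟨i, m - p, j, n - p, by omega, runL, runR, fun k hk => ?_⟩
    have := key (m - p + k) (by omega)
    rw [if_pos (by omega), if_neg (by omega)] at this
    convert this using 2 <;> omega

lemma exists_of_prefix_factorAt {A : Type*} {w : ℕ → A} {i n : ℕ} {u v : List A}
    (h : factorAt w i n = u ++ v) : u = factorAt w i u.length ∧
      v = factorAt w (i + u.length) v.length := by
  have hn : n = u.length + v.length := by simpa using congrArg List.length h
  rw [hn, factorAt_add] at h
  have := List.append_inj h (by simp)
  exact ⟨this.1.symm, this.2.symm⟩

lemma exists_of_infix_factorAt {A : Type*} {w : ℕ → A} {i n : ℕ} {s : List A}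
    (h : s <:+: factorAt w i n) : ∃ j, s = factorAt w j s.length := by
  obtain ⟨a, b, h⟩ := h
  have h₁ := (exists_of_prefix_factorAt h.symm).1
  exact ⟨_, (exists_of_prefix_factorAt h₁.symm).2⟩

/-- A factor of a conjugate either stays inside one of the two pieces, and then the second factor is
empty, or straddles the seam. The relative position of the pieces is deliberately forgotten. -/
lemma IsCircularFactor.exists_eq {A : Type*} {w : ℕ → A} {s : List A} (h : IsCircularFactor s w) :
    ∃ i m j n, s = factorAt w i m ++ factorAt w j n := by
  obtain ⟨f, c, ⟨i, n, rfl⟩, ⟨u, v, huv, rfl⟩, hs⟩ := h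
  obtain ⟨hu, hv⟩ := exists_of_prefix_factorAt huv
  rw [List.infix_append_iff] at hs
  rcases hs with hs | hs | ⟨a, b, rfl, ha, hb⟩
  · rw [hv] at hs
    obtain ⟨j, hj⟩ := exists_of_infix_factorAt hs
    exact ⟨j, s.length, 0, 0, by simpa [factorAt] using hj⟩
  · rw [hu] at hs
    obtain ⟨j, hj⟩ := exists_of_infix_factorAt hs
    exact ⟨j, s.length, 0, 0, by simpa [factorAt] using hj⟩
  · rw [hv] at ha
    rw [hu] at hb
    obtain ⟨j, hj⟩ := exists_of_infix_factorAt ha.isInfix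
    obtain ⟨k, hk⟩ := exists_of_infix_factorAt hb.isInfix
    exact ⟨j, a.length, k, b.length, by rw [← hj, ← hk]⟩

lemma circularlyPlusPowerFree_of_not_clash {A : Type*} {w : ℕ → A}
    (h : ∀ p i l j r, 0 < p → 5 * p < 4 * (l + r) → ¬ Clash w p i l j r) :
    CircularlyPlusPowerFree (13 / 4) w := by
  rintro s hs ⟨β, hβ, hpow⟩
  obtain ⟨p, hp, hper, hlen⟩ := hpow.hasPeriod
  obtain ⟨i, m, j, n, rfl⟩ := hs.exists_eq
  have hβ' : (13 / 4 : ℚ) < β := by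
    have : ((13 / 4 : ℚ) : ℝ) < β := by push_cast; exact hβ
    exact_mod_cast this
  have hlt : 13 * p < 4 * (m + n) := by
    have hp' : (0 : ℚ) < p := by exact_mod_cast hp
    have : (13 / 4 : ℚ) * p < β * p := by gcongr
    rw [← hlen] at this
    simp only [List.length_append, length_factorAt] at this
    have h' : (13 : ℚ) * p < 4 * ((m + n : ℕ) : ℚ) := by linarith
    exact_mod_cast h'
  obtain ⟨i, l, j, r, hlr, hc⟩ := exists_clash hlt hper
  exact h p i l j r hp hlr hc

/-! ### The lower bound -/

lemma exists_isPower (w : ℕ → Fin 3) :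
    ∃ s, IsCircularFactor s w ∧ ∃ β : ℚ, 13 / 4 ≤ β ∧ IsPower β s := by
  have h := not_good fun n => (w n).val
  have : ∃ p i l j r, 0 < p ∧ 5 * p ≤ 4 * (l + r) ∧ j + p + r ≤ i ∧ Clash w p i l j r := by
    by_contra! hcon
    exact h ⟨fun n => (w n).isLt, fun p i l j r hp hlr hij hc => hcon p i l j r hp hlr hij
      ⟨fun k hk => Fin.ext (hc.left k hk), fun k hk => Fin.ext (hc.right k hk),
        fun k hk => Fin.ext (hc.mid k hk)⟩⟩
  obtain ⟨p, i, l, j, r, hp, hlr, hij, hc⟩ := this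
  have hp' : (0 : ℚ) < p := by exact_mod_cast hp
  refine ⟨_, ?_, _, ?_, isPower_of_hasPeriod hp hc.hasPeriod (by simp; omega)⟩
  -- As `u` ends before `v` begins, some factor is `u d v`; its conjugate `v u d` starts with `vu`.
  · obtain ⟨d, rfl⟩ := Nat.exists_eq_add_of_le hij
    refine ⟨_, _, ⟨j, (p + r) + d + (l + p), rfl⟩, ⟨factorAt w j (p + r + d), _,
      factorAt_add w _ _ _, rfl⟩, ?_⟩
    rw [factorAt_add w j (p + r) d, ← List.append_assoc, ← add_assoc j, ← add_assoc j]
    exact (List.prefix_append _ _).isInfix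
  · rw [le_div_iff₀ hp']
    simp only [List.length_append, length_factorAt]
    have : (13 * p : ℚ) ≤ 4 * ((l + p + (p + r) : ℕ) : ℚ) := by
      exact_mod_cast (by omega : 13 * p ≤ 4 * (l + p + (p + r)))
    linarith

lemma not_circularlyPowerFree (w : ℕ → Fin 3) : ¬ CircularlyPowerFree (13 / 4) w := by
  rintro ⟨h₁, h₂⟩
  obtain ⟨s, hs, β, hβ, hpow⟩ := exists_isPower w
  rcases hβ.lt_or_eq with h | rfl
  · exact h₁ s hs ⟨β, by exact_mod_cast h, hpow⟩
  · exact h₂ s hs hpow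

lemma le_of_circularlyPlusPowerFree {r : ℝ} {w : ℕ → Fin 3} (h : CircularlyPlusPowerFree r w) :
    13 / 4 ≤ r := by
  by_contra! hr
  obtain ⟨s, hs, β, hβ, hpow⟩ := exists_isPower w
  refine h s hs ⟨β, hr.trans_le ?_, hpow⟩
  have : ((13 / 4 : ℚ) : ℝ) ≤ β := by exact_mod_cast hβ
  push_cast at this
  exact this

/-! ### Desubstitution of clashes -/

/-- The infinite word `s` is the image of `t` under the uniform morphism `h`. -/
def IsImage {A B : Type*} {q : ℕ} (h : A → Fin q → B) (t : ℕ → A) (s : ℕ → B) : Prop :=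
  ∀ a (b : Fin q), s (q * a + b) = h (t a) b

/-- Conditions on a uniform morphism `h` under which long clashes in an image under `h` come from
clashes: images of distinct letters have common suffixes of length at most `c₁` and common
prefixes of length at most `c₂`, and for every cut of the image of a letter, that letter is
determined by one of the two parts. -/
structure IsCode {A B : Type*} {q : ℕ} (h : A → Fin q → B) (c₁ c₂ : ℕ) : Prop where
  suffix_lt : c₁ < q
  prefix_lt : c₂ < q
  eq_of_suffix : ∀ x y, (∀ b : Fin q, q ≤ b + (c₁ + 1) → h x b = h y b) → x = y
  eq_of_prefix : ∀ x y, (∀ b : Fin q, (b : ℕ) ≤ c₂ → h x b = h y b) → x = y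
  cut : ∀ x (φ : Fin q), (∀ y, (∀ b < φ, h x b = h y b) → x = y) ∨
    (∀ y, (∀ b, φ ≤ b → h x b = h y b) → x = y)

/-- The positions of the factors of length `m` of `s` are determined modulo `q`. -/
def Syncs {B : Type*} (s : ℕ → B) (q m : ℕ) : Prop :=
  ∀ i j, (∀ k < m, s (i + k) = s (j + k)) → i % q = j % q

/-- One of the runs has length at least `m`, so some factor of length `m` reappears at distance `p`;
synchronization gives `p ≡ 0` modulo `q`. -/
lemma Clash.dvd {B : Type*} {s : ℕ → B} {q m p i l j r : ℕ} (hsync : Syncs s q m)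
    (h : Clash s p i l j r) (hlr : 2 * m ≤ l + r + 1) : q ∣ p := by
  have key : ∀ a n, m ≤ n → Run s p a n → q ∣ p := by
    intro a n hn hr
    have h₁ := hsync a (a + p) fun k hk => by
      rw [hr k (by omega)]
      congr 1
      ring
    have h₂ : a + p ≡ a + 0 [MOD q] := h₁.symm
    exact (Nat.modEq_zero_iff_dvd).1 (Nat.ModEq.add_left_cancel' a h₂)
  rcases le_or_gt m l with hl | hl
  · exact key i l hl h.left
  · exact key j r (by omega) h.right

/-- The overlap synchronizes the two sides, so both seams cut a block at the same offset `φ`. Full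
blocks pull back at once; the work is in the seam blocks at `E`, `J`, `E + p`, `J + p`. The loss `c₁
+ c₂` comes from partial blocks at the outer ends. -/
lemma Clash.desubstitute {A B : Type*} {q : ℕ} {h : A → Fin q → B} {c₁ c₂ m : ℕ}
    (hh : IsCode h c₁ c₂) {t : ℕ → A} {s : ℕ → B} (hs : IsImage h t s) (hsync : Syncs s q m)
    (hqm : q ≤ m) {p i l j r : ℕ} (hc : Clash s p i l j r) (hp : m ≤ p)
    (hlr : 2 * m ≤ l + r + 1) :
    ∃ p' i' l' j' r', p = q * p' ∧ Clash t p' i' l' j' r' ∧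
      l + r ≤ q * (l' + r') + c₁ + c₂ := by
  obtain ⟨p, rfl⟩ := hc.dvd hsync hlr
  have hq : 0 < q := by have := hh.suffix_lt; omega
  have hp0 : 0 < p := Nat.pos_of_ne_zero fun h0 => by subst h0; omega
  have hqp : q ≤ q * p := Nat.le_mul_of_pos_right q hp0
  -- equality of letters of `s` in terms of blocks
  have block : ∀ {x y a a' : ℕ} (b : Fin q), s x = s y → x = q * a + b → y = q * a' + b →
      h (t a) b = h (t a') b := by
    rintro _ _ a a' b hxy rfl rfl
    rw [← hs, ← hs, hxy]
  have hφ : (i + l) % q = j % q := hsync _ _ fun k hk => hc.mid k (by omega)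
  obtain ⟨φ, E, hE⟩ : ∃ (φ : Fin q) (E : ℕ), i + l = q * E + φ :=
    ⟨⟨(i + l) % q, Nat.mod_lt _ hq⟩, (i + l) / q, (Nat.div_add_mod _ _).symm⟩
  obtain ⟨J, hJ⟩ : ∃ J, j = q * J + φ := by
    refine ⟨j / q, ?_⟩
    rw [hE, Nat.mul_add_mod, Nat.mod_eq_of_lt φ.isLt] at hφ
    rw [hφ, Nat.div_add_mod]
  have hφq := φ.isLt
  have hc1 := hh.suffix_lt
  have hc2 := hh.prefix_lt
  have eq_of_all : ∀ x y, (∀ b, h x b = h y b) → x = y := fun x y hxy =>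
    hh.eq_of_prefix x y fun b _ => hxy b
  have hAB : ∀ b, φ ≤ b → h (t E) b = h (t J) b := fun b hb => by
    have hb' : (φ : ℕ) ≤ b := hb
    have := b.isLt
    exact block b (hc.mid (b - φ) (by omega)) (by omega) (by omega)
  have hCD : ∀ b < φ, h (t (E + p)) b = h (t (J + p)) b := fun b hb => by
    have hb' : (b : ℕ) < φ := hb
    refine block b (hc.mid (q * p + b - φ) (by omega)) ?_ ?_ <;> rw [Nat.mul_add] <;> omega
  have hmid : ∀ e, 0 < e → e < p → t (E + e) = t (J + e) := fun e he hep => eq_of_all _ _ fun b => by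
    have h₁ : q * (e + 1) ≤ q * p := Nat.mul_le_mul_left q hep
    have h₂ : q ≤ q * e := Nat.le_mul_of_pos_right q he
    rw [Nat.mul_add, mul_one] at h₁
    have := b.isLt
    refine block b (hc.mid (q * e + b - φ) (by omega)) ?_ ?_ <;> rw [Nat.mul_add] <;> omega
  have hAC : ∀ b < φ, φ ≤ b + l → h (t E) b = h (t (E + p)) b := fun b hb hbl => by
    have hb' : (b : ℕ) < φ := hb
    refine block b (hc.left (b + l - φ) (by omega)) (by omega) ?_
    rw [Nat.mul_add]
    omega
  have hBD : ∀ b, φ ≤ b → b < φ + r → h (t J) b = h (t (J + p)) b := fun b hb hbr => by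
    have hb' : (φ : ℕ) ≤ b := hb
    refine block b (hc.right (b - φ) (by omega)) (by omega) ?_
    rw [Nat.mul_add]
    omega
  -- the blocks covered by the two runs
  obtain ⟨I, hI, hI'⟩ : ∃ I, q * I ≤ i + c₁ ∧ ∀ K, I ≤ K → i + c₁ + 1 ≤ q * K + q := by
    refine ⟨(i + c₁) / q, Nat.mul_div_le _ _, fun K hK => ?_⟩
    have h₁ := Nat.lt_mul_div_succ (i + c₁) hq
    have h₂ := Nat.mul_le_mul_left q hK
    rw [Nat.mul_add, mul_one] at h₁
    omega
  obtain ⟨F, hF, hF'⟩ : ∃ F, j + r ≤ q * F + c₂ ∧ ∀ K < F, q * K + c₂ < j + r := by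
    refine ⟨(j + r + (q - 1 - c₂)) / q, ?_, fun K hK => ?_⟩
    · have h₁ := Nat.lt_mul_div_succ (j + r + (q - 1 - c₂)) hq
      rw [Nat.mul_add, mul_one] at h₁
      omega
    · have h₁ := Nat.mul_div_le (j + r + (q - 1 - c₂)) q
      have h₂ : q * (K + 1) ≤ _ := Nat.mul_le_mul_left q hK
      rw [Nat.mul_add, mul_one] at h₂
      omega
  have hleft : ∀ K, I ≤ K → K < E → t K = t (K + p) := fun K hK hKE =>
    hh.eq_of_suffix _ _ fun b hb => by
      have h₁ := hI' K hK
      have h₂ : q * (K + 1) ≤ q * E := Nat.mul_le_mul_left q hKE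
      rw [Nat.mul_add, mul_one] at h₂
      have := b.isLt
      refine block b (hc.left (q * K + b - i) (by omega)) (by omega) ?_
      rw [Nat.mul_add]
      omega
  have hright : ∀ K, J < K → K < F → t K = t (K + p) := fun K hK hKF =>
    hh.eq_of_prefix _ _ fun b hb => by
      have h₁ := hF' K hKF
      have h₂ : q * (J + 1) ≤ q * K := Nat.mul_le_mul_left q hK
      rw [Nat.mul_add, mul_one] at h₂
      refine block b (hc.right (q * K + b - j) (by omega)) (by omega) ?_
      rw [Nat.mul_add]
      omega
  -- The `min` puts the start at `e` when `I > e`, where the truncated length is 0.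
  have runL : ∀ e ≤ E, Run t p (min I e) (e - I) := fun e he k hk => by
    rw [min_eq_left (by omega)]
    exact hleft _ (by omega) (by omega)
  have runR : Run t p (J + 1) (F - (J + 1)) := fun k hk => hright _ (by omega) (by omega)
  by_cases hAD : t E = t (J + p)
  -- If the prefix part determines the letter, block `E` joins the left run; otherwise block `J`
  -- joins the right run.
  · rcases hh.cut (t E) φ with hcut | hcut
    · have hC : t E = t (E + p) := hcut _ fun b hb => by rw [hCD b hb, hAD]
      refine ⟨p, min I (E + 1), E + 1 - I, J + 1, F - (J + 1), rfl, ⟨fun k hk => ?_, runR,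
        fun k hk => ?_⟩, ?_⟩
      · rw [min_eq_left (by omega)]
        rcases Nat.lt_or_ge (I + k) E with hlt | hge
        · exact hleft _ (by omega) hlt
        · rw [show I + k = E by omega]
          exact hC
      · rw [show min I (E + 1) + (E + 1 - I) + k = E + (k + 1) by omega,
          show J + 1 + k = J + (k + 1) by ring]
        rcases Nat.lt_or_ge (k + 1) p with hlt | hge
        · exact hmid _ (by omega) hlt
        · rw [show k + 1 = p by omega, ← hC, hAD]
      · rw [Nat.mul_add, Nat.mul_sub, Nat.mul_sub, Nat.mul_add, Nat.mul_add, mul_one]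
        omega
    · have hB : t E = t J := hcut _ hAB
      refine ⟨p, min I E, E - I, J, F - J, rfl, ⟨runL E le_rfl, fun k hk => ?_,
        fun k hk => ?_⟩, ?_⟩
      · rcases Nat.eq_zero_or_pos k with rfl | hpos
        · rw [add_zero, ← hB, hAD]
        · exact hright _ (by omega) (by omega)
      · rw [show min I E + (E - I) + k = E + k by omega]
        rcases Nat.eq_zero_or_pos k with rfl | hpos
        · exact hB
        · exact hmid k hpos hk
      · rw [Nat.mul_add, Nat.mul_sub, Nat.mul_sub]
        omega
  -- Distinct letters at `E` and `J + p` can agree only briefly around the cut. So one side is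
  -- short, and the other run alone is pulled back.
  · have agree : ∀ b : Fin q, (φ : ℕ) ≤ b + l → (b : ℕ) < φ + r → h (t E) b = h (t (J + p)) b := by
      intro b hb hbr
      rcases lt_or_ge b φ with hlt | hge
      · rw [hAC b hlt hb, hCD b hlt]
      · rw [hAB b hge, hBD b hge hbr]
    rcases le_or_gt (φ : ℕ) l with hl | hl
    · have hr : φ + r ≤ c₂ := by
        by_contra hcon
        exact hAD (hh.eq_of_prefix _ _ fun b hb => agree b (by omega) (by omega))
      refine ⟨p, min I E, E - I, min I E + (E - I), 0, rfl, ⟨runL E le_rfl,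
        fun k hk => by omega, fun k _ => rfl⟩, ?_⟩
      rw [add_zero, Nat.mul_sub]
      omega
    · have hl' : l + q ≤ φ + c₁ := by
        by_contra hcon
        exact hAD (hh.eq_of_suffix _ _ fun b hb => agree b (by omega) (by omega))
      refine ⟨p, J + 1, 0, J + 1, F - (J + 1), rfl, ⟨fun k hk => by omega, runR,
        fun k _ => rfl⟩, ?_⟩
      rw [zero_add, Nat.mul_sub, Nat.mul_add, mul_one]
      omega

/-! ### Factors of morphic words -/

lemma length_applyMorphism {A B : Type*} {q : ℕ} (h : A → Fin q → B) (x : List A) :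
    (applyMorphism h x).length = q * x.length := by
  induction x with
  | nil => simp [applyMorphism]
  | cons a x ih =>
    simp only [applyMorphism, List.flatMap_cons, List.length_append, List.length_ofFn,
      List.length_cons] at ih ⊢
    rw [ih, Nat.mul_add]
    omega

lemma getElem?_applyMorphism {A B : Type*} {q : ℕ} (h : A → Fin q → B) {x : List A} {n : ℕ} {a : A}
    (hx : x[n]? = some a) (b : Fin q) : (applyMorphism h x)[q * n + b]? = some (h a b) := by
  induction x generalizing n with
  | nil => simp at hx
  | cons c x ih =>
    simp only [applyMorphism, List.flatMap_cons] at ih ⊢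
    cases n with
    | zero =>
      obtain rfl : c = a := by simpa using hx
      rw [List.getElem?_append_left (by simp)]
      simp
    | succ n =>
      rw [List.getElem?_append_right (by simp [Nat.mul_add]; omega), List.length_ofFn,
        show q * (n + 1) + b - q = q * n + b by rw [Nat.mul_add]; omega]
      exact ih (by simpa using hx)

lemma applyMorphism_factorAt {A B : Type*} {q : ℕ} {h : A → Fin q → B} {t : ℕ → A} {s : ℕ → B}
    (hs : IsImage h t s) (a n : ℕ) :
    applyMorphism h (factorAt t a n) = factorAt s (q * a) (q * n) := by
  refine List.ext_getElem? fun k => ?_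
  rcases lt_or_ge k (q * n) with hk | hk
  · have hq : 0 < q := Nat.pos_of_mul_pos_right (by omega : 0 < q * n)
    have e := Nat.div_add_mod k q
    have hlt : k / q < n := Nat.div_lt_of_lt_mul hk
    have := getElem?_applyMorphism h (getElem?_factorAt t (i := a) hlt) ⟨k % q, Nat.mod_lt _ hq⟩
    simp only [e] at this
    rw [this, getElem?_factorAt s hk, ← hs]
    congr 2
    rw [Nat.mul_add]
    simp only
    omega
  · rw [List.getElem?_eq_none (by simpa [length_applyMorphism] using hk),
      List.getElem?_eq_none (by simpa using hk)]

lemma isImage_applyMorphismInf {A B : Type*} {q : ℕ} [NeZero q] (h : A → Fin q → B) (t : ℕ → A) :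
    IsImage h t (applyMorphismInf h t) := by
  intro a b
  have hq : 0 < q := Nat.pos_of_ne_zero (NeZero.ne q)
  have h₁ : (q * a + b) / q = a := by
    rw [Nat.mul_add_div hq, Nat.div_eq_of_lt b.isLt, add_zero]
  have h₂ : Fin.ofNat q (q * a + b) = b := by
    ext
    simp [Fin.ofNat, Nat.mod_eq_of_lt b.isLt]
  rw [applyMorphismInf, h₁, h₂]

lemma applyMorphism_prefix {A B : Type*} {q : ℕ} (h : A → Fin q → B) {x y : List A} (hxy : x <+: y) :
    applyMorphism h x <+: applyMorphism h y := by
  obtain ⟨z, rfl⟩ := hxy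
  simp [applyMorphism]

/-- Since `h a` starts with `a`, the iterates form a chain of prefixes, so any long enough iterate
gives the same letter at a given position. -/
lemma isImage_omegaPower {A : Type*} {q : ℕ} (hq : 2 ≤ q) (h : A → Fin q → A) (a : A)
    (ha : h a ⟨0, by omega⟩ = a) : IsImage h (omegaPower h a) (omegaPower h a) := by
  have step : ∀ n, (applyMorphism h)^[n] [a] <+: (applyMorphism h)^[n + 1] [a] := by
    intro n
    induction n with
    | zero =>
      have := getElem?_applyMorphism h (x := [a]) (n := 0) (a := a) rfl ⟨0, by omega⟩
      rw [ha] at this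
      simp only [Function.iterate_zero, id_eq, zero_add, Function.iterate_one,
        List.prefix_iff_getElem?]
      intro k hk
      obtain rfl : k = 0 := by simpa using hk
      simpa using this
    | succ n ih =>
      rw [Function.iterate_succ_apply', Function.iterate_succ_apply' _ (n + 1)]
      exact applyMorphism_prefix h ih
  have mono : ∀ m n, m ≤ n → (applyMorphism h)^[m] [a] <+: (applyMorphism h)^[n] [a] := by
    intro m n hmn
    induction n, hmn using Nat.le_induction with
    | base => exact List.prefix_rfl
    | succ n _ ih => exact ih.trans (step n)
  have len : ∀ n, ((applyMorphism h)^[n] [a]).length = q ^ n := by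
    intro n
    induction n with
    | zero => rfl
    | succ n ih => rw [Function.iterate_succ_apply', length_applyMorphism, ih, pow_succ']
  have get : ∀ n k, k < q ^ n → ((applyMorphism h)^[n] [a])[k]? = some (omegaPower h a k) := by
    intro n k hk
    have hk' : k < q ^ (k + 1) :=
      (Nat.lt_pow_self (by omega)).trans (Nat.pow_lt_pow_right (by omega) (by omega))
    have e : ((applyMorphism h)^[k + 1] [a])[k]? = some (omegaPower h a k) := by
      rw [omegaPower, List.getD_eq_getElem?_getD,
        List.getElem?_eq_getElem (by rw [len]; exact hk'), Option.getD_some]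
    rcases le_total n (k + 1) with hle | hle
    · rw [← e, List.getElem?_eq_getElem (by rw [len]; exact hk)]
      exact (List.prefix_iff_getElem?.1 (mono _ _ hle) k (by rw [len]; exact hk)).symm
    · have := List.prefix_iff_getElem?.1 (mono _ _ hle) k (by rw [len]; exact hk')
      rw [this, ← e, List.getElem?_eq_getElem]
  intro n b
  have hn : n < q ^ n := Nat.lt_pow_self (by omega)
  have h₁ := getElem?_applyMorphism h (get n n hn) b
  rw [← Function.iterate_succ_apply' (applyMorphism h), get (n + 1)] at h₁
  · exact Option.some_inj.1 h₁
  · rw [pow_succ']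
    have : q * (n + 1) ≤ q * q ^ n := Nat.mul_le_mul_left q hn
    have := b.isLt
    rw [Nat.mul_add] at *
    omega

/-- All factors of length `n` of `t` are in the list `L`. -/
def FactorsIn {A : Type*} (t : ℕ → A) (n : ℕ) (L : List (List A)) : Prop := ∀ i, factorAt t i n ∈ L

/-- The factors of length `N`, starting in the first block, of the images under `h` of the words
in `L`. -/
def windows {A B : Type*} {q : ℕ} (h : A → Fin q → B) (N : ℕ) (L : List (List A)) :
    List (List B) :=
  L.flatMap fun x => (List.range q).map fun b => ((applyMorphism h x).drop b).take N

lemma drop_take_factorAt {A : Type*} (t : ℕ → A) {i n b N : ℕ} (h : b + N ≤ n) :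
    ((factorAt t i n).drop b).take N = factorAt t (i + b) N := by
  obtain ⟨c, rfl⟩ := Nat.exists_eq_add_of_le h
  rw [add_assoc, factorAt_add, List.drop_left' (by simp), factorAt_add, List.take_left' (by simp)]

lemma mem_windows {A B : Type*} {q : ℕ} {h : A → Fin q → B} {t : ℕ → A} {s : ℕ → B}
    (hs : IsImage h t s) {n N : ℕ} {L : List (List A)} {i : ℕ} (hN : q - 1 + N ≤ q * n)
    (hq : 0 < q) (hL : factorAt t (i / q) n ∈ L) : factorAt s i N ∈ windows h N L := by
  have hlt := Nat.mod_lt i hq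
  refine List.mem_flatMap.2 ⟨_, hL, List.mem_map.2 ⟨i % q, List.mem_range.2 hlt, ?_⟩⟩
  rw [applyMorphism_factorAt hs, drop_take_factorAt s (by omega), Nat.div_add_mod]

lemma FactorsIn.windows {A B : Type*} {q : ℕ} {h : A → Fin q → B} {t : ℕ → A} {s : ℕ → B}
    (hs : IsImage h t s) {n N : ℕ} {L : List (List A)} (hL : FactorsIn t n L)
    (hN : q - 1 + N ≤ q * n) (hq : 0 < q) : FactorsIn s N (windows h N L) :=
  fun _ => mem_windows hs hN hq (hL _)

/-- If a list contains the first factor of length `2` of a fixed point and is closed under taking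
factors of images, it contains all factors of length `2`. -/
lemma factorsIn_two {A : Type*} {q : ℕ} (hq : 2 ≤ q) {h : A → Fin q → A} {t : ℕ → A}
    (ht : IsImage h t t) {L : List (List A)} (h0 : factorAt t 0 2 ∈ L)
    (hL : ∀ x ∈ CircularWords.windows h 2 L, x ∈ L) : FactorsIn t 2 L := by
  intro i
  induction i using Nat.strong_induction_on with
  | _ i ih =>
    rcases Nat.eq_zero_or_pos i with rfl | hi
    · exact h0
    · exact hL _ (mem_windows ht (by omega) (by omega) (ih _ (Nat.div_lt_self hi (by omega))))

/-! ### Codes of windows -/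

/-- The letters of an infinite word over `Fin k`, as natural numbers. -/
def num {k : ℕ} (s : ℕ → Fin k) : ℕ → ℕ := fun n => (s n).val

lemma num_lt {k : ℕ} (hk : k ≤ 8) (s : ℕ → Fin k) (n : ℕ) : num s n < 8 :=
  (s n).isLt.trans_le hk

lemma code_factorAt {k : ℕ} (s : ℕ → Fin k) (i n : ℕ) :
    code ((factorAt s i n).map Fin.val) = enc (num s) i n := by
  induction n generalizing i with
  | zero => rfl
  | succ n ih =>
    rw [add_comm, factorAt_add, List.map_append]
    change num s i + 8 * code ((factorAt s (i + 1) n).map Fin.val) = _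
    rw [ih, add_comm 1, enc]

/-- The codes of the images of the words in `L`. -/
def codes {A : Type*} {q k : ℕ} (h : A → Fin q → Fin k) (L : List (List A)) : List ℕ :=
  L.map fun x => code ((applyMorphism h x).map Fin.val)

lemma enc_mem_codes {A : Type*} {q k : ℕ} {h : A → Fin q → Fin k} {t : ℕ → A} {s : ℕ → Fin k}
    (hs : IsImage h t s) {n : ℕ} {L : List (List A)} (hL : FactorsIn t n L) (a : ℕ) :
    enc (num s) (q * a) (q * n) ∈ codes h L := by
  rw [← code_factorAt, ← applyMorphism_factorAt hs]
  exact List.mem_map.2 ⟨_, hL a, rfl⟩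

/-- The factors of length `m` of the words with codes in `C` that start at distinct positions less
than `q` are distinct. -/
def syncCheck (q m : ℕ) (C : List ℕ) : Bool :=
  (List.range q).all fun b => (List.range b).all fun b' => C.all fun X => C.all fun Y =>
    !Nat.beq (X / 8 ^ b % 8 ^ m) (Y / 8 ^ b' % 8 ^ m)

lemma syncs_of_syncCheck {A : Type*} {q k : ℕ} (hk : k ≤ 8) {h : A → Fin q → Fin k} {t : ℕ → A}
    {s : ℕ → Fin k} (hs : IsImage h t s) {n m : ℕ} {L : List (List A)} (hL : FactorsIn t n L)
    (hq : 0 < q) (hm : q - 1 + m ≤ q * n) (hc : syncCheck q m (codes h L) = true) :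
    Syncs s q m := by
  have key : ∀ i j, i % q < j % q → ¬ ∀ k < m, s (i + k) = s (j + k) := by
    intro i j hlt heq
    have e : enc (num s) i m = enc (num s) j m :=
      (enc_eq_iff (num_lt hk s) (num_lt hk s) i j m).2 fun k hk => congrArg Fin.val (heq k hk)
    simp only [syncCheck, List.all_eq_true, List.mem_range] at hc
    have hi := Nat.mod_lt i hq
    have hj := Nat.mod_lt j hq
    have := hc _ hj _ hlt _ (enc_mem_codes hs hL (j / q)) _ (enc_mem_codes hs hL (i / q))
    rw [enc_sub (num_lt hk s) _ (by omega), enc_sub (num_lt hk s) _ (by omega), Nat.div_add_mod,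
      Nat.div_add_mod, e] at this
    simp at this
  intro i j heq
  rcases lt_trichotomy (i % q) (j % q) with hlt | heq' | hlt
  · exact (key i j hlt heq).elim
  · exact heq'
  · exact (key j i hlt fun k hk => (heq k hk).symm).elim

/-- The codes in `W` of words that start with a word of length `l + p` and period `p`. -/
def withRun (p : ℕ) (W : List ℕ) : ℕ → List ℕ
  | 0 => W
  | l + 1 => (withRun p W l).filter fun x => Nat.beq (x / 8 ^ l % 8) (x / 8 ^ (l + p) % 8)

/-- No words with codes in `W` give a clash of period `p` with runs of total length `T`. -/
def clashCheck (W : List ℕ) (p T : ℕ) : Bool :=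
  (List.range (T + 1)).all fun l => (withRun p W l).all fun x => (withRun p W (T - l)).all fun y =>
    !Nat.beq (x / 8 ^ l % 8 ^ p) (y % 8 ^ p)

lemma enc_digit {s : ℕ → ℕ} (hs : ∀ n, s n < 8) (i : ℕ) {a n : ℕ} (h : a < n) :
    enc s i n / 8 ^ a % 8 = s (i + a) := by
  have := enc_sub hs i (b := 1) h
  simpa [enc] using this

lemma mem_withRun {s : ℕ → ℕ} (hs : ∀ n, s n < 8) {W : List ℕ} {p N i l : ℕ} (hN : l + p ≤ N)
    (hW : enc s i N ∈ W) (hr : Run s p i l) : enc s i N ∈ withRun p W l := by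
  induction l with
  | zero => exact hW
  | succ l ih =>
    rw [withRun, List.mem_filter, Nat.beq_eq]
    refine ⟨ih (by omega) fun k hk => hr k (by omega), ?_⟩
    rw [enc_digit hs i (by omega), enc_digit hs i (by omega), hr l (by omega), add_assoc]

lemma not_clash_of_clashCheck {k : ℕ} (hk : k ≤ 8) {s : ℕ → Fin k} {W : List ℕ} {N p T : ℕ}
    (hW : ∀ i, enc (num s) i N ∈ W) (hN : T + p ≤ N) (hc : clashCheck W p T = true)
    {i l j r : ℕ} (hT : T ≤ l + r) : ¬ Clash s p i l j r := by
  intro h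
  have h8 := num_lt hk s
  -- Trim the runs at their outer ends to total length exactly `T`; the overlap is untouched.
  obtain ⟨l', r', d, rfl, hr', hlr⟩ : ∃ l' r' d, l = d + l' ∧ r' ≤ r ∧ l' + r' = T :=
    ⟨min l T, T - min l T, l - min l T, by omega, by omega, by omega⟩
  simp only [clashCheck, List.all_eq_true, List.mem_range] at hc
  have hx : enc (num s) (i + d) N ∈ withRun p W l' :=
    mem_withRun h8 (by omega) (hW _) fun k hk => by
      have := h.left (d + k) (by omega)
      rw [← add_assoc] at this
      exact congrArg Fin.val this
  have hy : enc (num s) j N ∈ withRun p W (T - l') :=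
    mem_withRun h8 (by omega) (hW _) fun k hk => congrArg Fin.val (h.right k (by omega))
  have := hc l' (by omega) _ hx _ hy
  have e := enc_sub h8 j (a := 0) (b := p) (n := N) (by omega)
  rw [pow_zero, Nat.div_one, add_zero] at e
  rw [e, enc_sub h8 _ (by omega)] at this
  have e' : enc (num s) (i + d + l') p = enc (num s) j p := by
    rw [enc_eq_iff h8 h8]
    intro k hk
    have := h.mid k hk
    rw [← add_assoc] at this
    exact congrArg Fin.val this
  rw [e'] at this
  simp at this

/-- The codes of the words of length `N` that start in the first block of the image of a word
in `L`. -/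
def windowCodes {A : Type*} {q k : ℕ} (h : A → Fin q → Fin k) (N : ℕ) (L : List (List A)) :
    List ℕ :=
  (codes h L).flatMap fun X => (List.range q).map fun b => X / 8 ^ b % 8 ^ N

lemma enc_mem_windowCodes {A : Type*} {q k : ℕ} (hk : k ≤ 8) {h : A → Fin q → Fin k} {t : ℕ → A}
    {s : ℕ → Fin k} (hs : IsImage h t s) {n N : ℕ} {L : List (List A)} (hL : FactorsIn t n L)
    (hq : 0 < q) (hN : q - 1 + N ≤ q * n) (i : ℕ) : enc (num s) i N ∈ windowCodes h N L := by
  have hlt := Nat.mod_lt i hq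
  refine List.mem_flatMap.2 ⟨_, enc_mem_codes hs hL (i / q), List.mem_map.2 ⟨i % q,
    List.mem_range.2 hlt, ?_⟩⟩
  rw [enc_sub (num_lt hk s) _ (by omega), Nat.div_add_mod]

/-! ### The word `ψ^ω(0)` and its image under `μ` -/

/-- The fixed point of `ψ` that starts with `0`. -/
abbrev psiWord : ℕ → Fin 6 := omegaPower psi 0

/-- The image under `μ` of the fixed point of `ψ`. -/
abbrev muWord : ℕ → Fin 3 := applyMorphismInf mu psiWord

lemma isImage_psiWord : IsImage psi psiWord psiWord := isImage_omegaPower (by norm_num) psi 0 rfl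

lemma isImage_muWord : IsImage mu psiWord muWord := isImage_applyMorphismInf mu psiWord

/-- The factors of length `2` of the fixed point of `ψ`. -/
def factors₂ : List (List (Fin 6)) :=
  [[0, 4], [0, 5], [1, 0], [1, 3], [2, 3], [3, 4], [3, 5], [4, 0], [4, 1], [4, 2], [4, 3], [5, 4]]

/-- The factors of length `3` of the fixed point of `ψ`. -/
def factors₃ : List (List (Fin 6)) := (windows psi 3 factors₂).dedup

/-- The factors of length `6` of the fixed point of `ψ`. -/
def factors₆ : List (List (Fin 6)) := (windows psi 6 factors₃).dedup

lemma factorsIn_factors₂ : FactorsIn psiWord 2 factors₂ := by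
  refine factorsIn_two (by norm_num) isImage_psiWord ?_ (by decide +kernel)
  rw [show factorAt psiWord 0 2 = [0, 4] by decide +kernel]
  simp [factors₂]

lemma factorsIn_factors₃ : FactorsIn psiWord 3 factors₃ := fun i =>
  List.mem_dedup.2 (factorsIn_factors₂.windows isImage_psiWord (by norm_num) (by norm_num) i)

lemma factorsIn_factors₆ : FactorsIn psiWord 6 factors₆ := fun i =>
  List.mem_dedup.2 (factorsIn_factors₃.windows isImage_psiWord (by norm_num) (by norm_num) i)

lemma isCode_psi : IsCode psi 1 3 where
  suffix_lt := by norm_num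
  prefix_lt := by norm_num
  eq_of_suffix := by decide +kernel
  eq_of_prefix := by decide +kernel
  cut := by decide +kernel

lemma isCode_mu : IsCode mu 11 6 where
  suffix_lt := by norm_num
  prefix_lt := by norm_num
  eq_of_suffix := by decide +kernel
  eq_of_prefix := by decide +kernel
  cut := by decide +kernel

lemma syncs_psiWord : Syncs psiWord 4 5 :=
  syncs_of_syncCheck (by norm_num) isImage_psiWord factorsIn_factors₂ (by norm_num) (by norm_num)
    (by decide +kernel)

lemma syncs_muWord : Syncs muWord 15 19 :=
  syncs_of_syncCheck (by norm_num) isImage_muWord factorsIn_factors₃ (by norm_num) (by norm_num)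
    (by decide +kernel)

lemma clashCheck_psiWord_two : (List.range 2).all (fun p =>
    clashCheck (windowCodes psi 17 factors₆) (p + 1) (p + 1)) = true := by
  decide +kernel

/-- The threshold is `⌈(5P - 6)/4⌉` for the period `P = p + 3`. The window 17 is the largest `T +
P`, reached at `P = 8`. -/
lemma clashCheck_psiWord : (List.range 6).all (fun p =>
    clashCheck (windowCodes psi 17 factors₆) (p + 3) ((5 * p + 12) / 4)) = true := by
  decide +kernel

lemma clashCheck_muWord : (List.range 29).all (fun p =>
    clashCheck (windowCodes mu 66 factors₆) (p + 1) (5 * (p + 1) / 4 + 1)) = true := by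
  decide +kernel

/-- The slack 6 survives descent: with `c₁ + c₂ = 4`, `20p' ≤ 4(4L + 4) + 6` gives `5p' ≤ 4L + 6`.
Periods 1 and 2 are left out because this slack is too weak for them: at period 1 it allows empty
runs. -/
lemma psiWord_not_clash_of_two_lt {p : ℕ} (hp : 2 < p) {i l j r : ℕ}
    (hlr : 5 * p ≤ 4 * (l + r) + 6) : ¬ Clash psiWord p i l j r := by
  induction p using Nat.strong_induction_on generalizing i l j r with
  | _ p ih =>
    intro h
    rcases lt_or_ge p 9 with hp' | hp'
    · obtain ⟨p, rfl⟩ := Nat.exists_eq_add_of_le' hp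
      have := List.all_eq_true.1 clashCheck_psiWord p (List.mem_range.2 (by omega))
      exact not_clash_of_clashCheck (by norm_num)
        (enc_mem_windowCodes (by norm_num) isImage_psiWord factorsIn_factors₆ (by norm_num)
          (by norm_num)) (by omega) this (by omega) h
    · obtain ⟨p, i, l', j, r', rfl, h', hlr'⟩ := h.desubstitute isCode_psi isImage_psiWord
        syncs_psiWord (by norm_num) (by omega) (by omega)
      exact ih p (by omega) (by omega) (by omega) h'

lemma psiWord_not_clash {p : ℕ} (hp : 0 < p) {i l j r : ℕ} (hlr : 5 * p ≤ 4 * (l + r) + 4) :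
    ¬ Clash psiWord p i l j r := by
  rcases lt_or_ge 2 p with hp' | hp'
  · exact psiWord_not_clash_of_two_lt hp' (by omega)
  · obtain ⟨p, rfl⟩ := Nat.exists_eq_add_of_le' hp
    have := List.all_eq_true.1 clashCheck_psiWord_two p (List.mem_range.2 (by omega))
    exact not_clash_of_clashCheck (by norm_num)
      (enc_mem_windowCodes (by norm_num) isImage_psiWord factorsIn_factors₆ (by norm_num)
        (by norm_num)) (by omega) this (by omega)

/-- For `p = 15p'` and `c₁ + c₂ = 17`, `75p' < 4(15L + 17)` gives `5p' ≤ 4L + 4`, the slack allowed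
in the fixed point. From `p = 30` on, `l + r ≥ 38 = 2 · 19`, enough to synchronize. -/
lemma muWord_not_clash {p i l j r : ℕ} (hp : 0 < p) (hlr : 5 * p < 4 * (l + r)) :
    ¬ Clash muWord p i l j r := by
  intro h
  rcases lt_or_ge p 30 with hp' | hp'
  · obtain ⟨p, rfl⟩ := Nat.exists_eq_add_of_le' hp
    have := List.all_eq_true.1 clashCheck_muWord p (List.mem_range.2 (by omega))
    exact not_clash_of_clashCheck (by norm_num)
      (enc_mem_windowCodes (by norm_num) isImage_muWord factorsIn_factors₆ (by norm_num)
        (by norm_num)) (by omega) this (by omega) h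
  · obtain ⟨p, i, l', j, r', rfl, h', hlr'⟩ := h.desubstitute isCode_mu isImage_muWord
      syncs_muWord (by norm_num) (by omega) (by omega)
    exact psiWord_not_clash (by omega) (by omega) h'

lemma circularlyPlusPowerFree_muWord : CircularlyPlusPowerFree (13 / 4) muWord :=
  circularlyPlusPowerFree_of_not_clash fun _ _ _ _ _ hp hlr => muWord_not_clash hp hlr

end CircularWords

theorem mainTheorem1 :
    CircularWords.IsCircularRepetitionThreshold 3 (13 / 4) ∧
    (∀ w : ℕ → Fin 3, ¬ CircularWords.CircularlyPowerFree (13 / 4) w) ∧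
    CircularWords.CircularlyPlusPowerFree (13 / 4)
      (CircularWords.applyMorphismInf CircularWords.mu
        (CircularWords.omegaPower CircularWords.psi 0)) := by
  refine ⟨⟨⟨_, CircularWords.circularlyPlusPowerFree_muWord⟩, ?_⟩,
    CircularWords.not_circularlyPowerFree, CircularWords.circularlyPlusPowerFree_muWord⟩
  rintro r ⟨w, hw⟩
  exact CircularWords.le_of_circularlyPlusPowerFree hw
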